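/- Let $k$ be a field of characteristic zero, $S$ a finite-dimensional semisimple Lie algebra over $k$ and $\mathfrak{m}$ a finite-dimensional $S$-module with representation $\rho:S\to\mathfrak{gl}(\mathfrak{m})$. Inside $\mathfrak{m}\otimes\bigwedge^2\mathfrak{m}$ let $$\mathfrak{s}=\mathrm{span}\{2x\otimes(y\wedge z)+y\otimes(x\wedge z)+z\otimes(y\wedge x) : x,y,z\in\mathfrak{m}\},$$ and let $\mathcal{N}(\mathfrak{m},3)=\mathfrak{m}\oplus\bigwedge^2\mathfrak{m}\oplus\mathfrak{s}$ be the free $3$-nilpotent Lie algebra generated by $\mathfrak{m}$, with products $[x,y]=x\wedge y$ and $[x,y\wedge z]=\tfrac23\,x\otimes(y\wedge z)+\tfrac13\,y\otimes(x\wedge z)+\tfrac13\,z\otimes(y\wedge x)$ for $x,y,z\in\mathfrak{m}$, all other products of homogeneous elements being zero, graded with $\mathfrak{m}$, $\bigwedge^2\mathfrak{m}$, $\mathfrak{s}$ in degrees $1,2,3$. The algebra $S$ acts on $\mathcal{N}(\mathfrak{m},3)$ by the derivations extending $\rho$, that is, by its natural actions on $\mathfrak{m}$, $\bigwedge^2\mathfrak{m}$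 and $\mathfrak{s}\subseteq\mathfrak{m}\otimes\bigwedge^2\mathfrak{m}$; an ideal of $\mathcal{N}(\mathfrak{m},3)$ that is also an $S$-submodule is called an $S$-ideal. For a Lie algebra $L$ put $L^1=L$ and $L^{j+1}=[L,L^{j}]$; $L$ is $t$-nilpotent if $L^{t+1}=0\neq L^t$. A quasi-cyclic Lie algebra is one isomorphic to the quotient of a free nilpotent Lie algebra on finitely many generators (graded by bracket length) by a homogeneous ideal. Let $I\subseteq\mathcal{N}(\mathfrak{m},3)^2=\bigwedge^2\mathfrak{m}\oplus\mathfrak{s}$ be a non-homogeneous $S$-ideal such that $\mathfrak{n}=\mathcal{N}(\mathfrak{m},3)/I$ is $3$-nilpotent and not quasi-cyclic (so that $S$, acting on $\mathfrak{n}$ by the induced derivations, is a Levi extension of $\mathfrak{n}$). Then: 1. there is an irreducible $S$-submodule $B$ of $\mathcal{N}(\mathfrak{m},3)$ with $B\subseteq I$ whose projections on $\bigwedge^2\mathfrak{m}$ and on $\mathfrak{s}$ are both nonzero and are isomorphic $S$-modules; 2. $\rho(S)\neq\mathfrak{sl}(\mathfrak{m})$, where $\mathfrak{sl}(\mathfrak{m})$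 is the Lie algebra of trace-zero endomorphisms of $\mathfrak{m}$; 3. $\mathcal{N}(\mathfrak{m},3)^3$ is not an irreducible $S$-module. -/

import Mathlib

open scoped TensorProduct

noncomputable section

/-! ### Exterior squares -/

namespace ExtSq

variable {k m P S : Type*} [Field k] [AddCommGroup m] [Module k m] [AddCommGroup P] [Module k P]

/-- The linear map `⋀² m → P` induced by an alternating bilinear map. -/
def lift (f : m →ₗ[k] m →ₗ[k] P) (hf : ∀ x, f x x = 0) : ⋀[k]^2 m →ₗ[k] P :=
  exteriorPower.alternatingMapLinearEquiv
    { toFun := fun v => f (v 0) (v 1)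
      map_update_add' := by
        intro _ v i x y
        fin_cases i <;> simp
      map_update_smul' := by
        intro _ v i c x
        fin_cases i <;> simp
      map_eq_zero_of_eq' := by
        intro v i j h hij
        have h01 : v 0 = v 1 := by
          fin_cases i <;> fin_cases j <;> simp_all
        rw [h01]
        exact hf _ }

variable (k) in
/-- The wedge product `(x, y) ↦ x ∧ y` as a bilinear map `m × m → ⋀² m`. -/
def wedge : m →ₗ[k] m →ₗ[k] ⋀[k]^2 m :=
  LinearMap.mk₂ k (fun x y => exteriorPower.ιMulti k 2 ![x, y])
    (fun x x' y => (exteriorPower.ιMulti k 2 (M := m)).toMultilinearMap.cons_add ![y] x x')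
    (fun c x y => (exteriorPower.ιMulti k 2 (M := m)).toMultilinearMap.cons_smul ![y] c x)
    (fun x y y' => by
      have h := (exteriorPower.ιMulti k 2 (M := m)).map_update_add ![x, 0] 1 y y'
      have e : ∀ w : m, Function.update ![x, 0] 1 w = ![x, w] := fun w => by
        ext i
        fin_cases i <;> rfl
      rwa [e, e, e] at h)
    (fun c x y => by
      have h := (exteriorPower.ιMulti k 2 (M := m)).map_update_smul ![x, 0] 1 c y
      have e : ∀ w : m, Function.update ![x, 0] 1 w = ![x, w] := fun w => by
        ext i
        fin_cases i <;> rfl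
      rwa [e, e] at h)

theorem wedge_apply (x y : m) : wedge k x y = exteriorPower.ιMulti k 2 ![x, y] := rfl

@[simp] theorem wedge_self (x : m) : wedge k x x = 0 :=
  (exteriorPower.ιMulti k 2 (M := m)).map_eq_zero_of_eq ![x, x] (i := 0) (j := 1) (by simp)
    (by simp)

theorem wedge_swap (x y : m) : wedge k x y = - wedge k y x := by
  have h := wedge_self (k := k) (x + y)
  simp only [map_add, LinearMap.add_apply, wedge_self, zero_add, add_zero] at h
  exact eq_neg_of_add_eq_zero_right h

@[simp] theorem lift_wedge (f : m →ₗ[k] m →ₗ[k] P) (hf : ∀ x, f x x = 0) (x y : m) :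
    lift f hf (wedge k x y) = f x y := by
  rw [lift, wedge_apply, exteriorPower.alternatingMapLinearEquiv_apply_ιMulti]
  rfl

theorem hom_ext {f g : ⋀[k]^2 m →ₗ[k] P} (h : ∀ x y, f (wedge k x y) = g (wedge k x y)) :
    f = g := by
  apply exteriorPower.linearMap_ext
  ext v
  have hv : v = ![v 0, v 1] := by
    ext i
    fin_cases i <;> rfl
  have := h (v 0) (v 1)
  rw [wedge_apply, ← hv] at this
  exact this

/-- The extension of an endomorphism `δ` of `m` to `⋀² m` by
`x ∧ y ↦ δ x ∧ y + x ∧ δ y`. -/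
def der (δ : Module.End k m) : Module.End k (⋀[k]^2 m) :=
  lift ((wedge k).comp δ + (wedge k).compl₂ δ) (fun x => by
    simp only [LinearMap.add_apply, LinearMap.comp_apply, LinearMap.compl₂_apply]
    rw [wedge_swap]
    simp)

@[simp] theorem der_wedge (δ : Module.End k m) (x y : m) :
    der δ (wedge k x y) = wedge k (δ x) y + wedge k x (δ y) := by
  simp [der]

variable [LieRing S] [LieAlgebra k S] [LieRingModule S m] [LieModule k S m]

/-- The natural action of a Lie algebra on the exterior square of a module. -/
instance instLieRingModule : LieRingModule S (⋀[k]^2 m) where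
  bracket a u := der (LieModule.toEnd k S m a) u
  add_lie a b u := by
    have h : der (LieModule.toEnd k S m (a + b)) =
        der (LieModule.toEnd k S m a) + der (LieModule.toEnd k S m b) :=
      hom_ext fun x y => by
        simp only [LinearMap.add_apply, der_wedge, LieModule.toEnd_apply_apply, map_add]
        abel
    exact LinearMap.congr_fun h u
  lie_add a u v := map_add _ u v
  leibniz_lie a b u := by
    have h : der (LieModule.toEnd k S m a) ∘ₗ der (LieModule.toEnd k S m b) =
        der (LieModule.toEnd k S m ⁅a, b⁆) +
          der (LieModule.toEnd k S m b) ∘ₗ der (LieModule.toEnd k S m a) :=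
      hom_ext fun x y => by
        simp only [LinearMap.add_apply, LinearMap.comp_apply, der_wedge,
          LieModule.toEnd_apply_apply, lie_lie, map_add, map_sub, LinearMap.sub_apply]
        abel
    exact LinearMap.congr_fun h u

theorem lie_def (a : S) (u : ⋀[k]^2 m) : ⁅a, u⁆ = der (LieModule.toEnd k S m a) u := rfl

@[simp] theorem lie_wedge (a : S) (x y : m) :
    ⁅a, wedge k x y⁆ = wedge k ⁅a, x⁆ y + wedge k x ⁅a, y⁆ := by
  simp [lie_def]

instance instLieModule : LieModule k S (⋀[k]^2 m) where
  smul_lie c a u := by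
    have h : der (LieModule.toEnd k S m (c • a)) = c • der (LieModule.toEnd k S m a) :=
      hom_ext fun x y => by simp
    exact LinearMap.congr_fun h u
  lie_smul c a u := map_smul _ c u

end ExtSq

/-! ### The free 3-nilpotent Lie algebra `𝒩(𝔪,3) = 𝔪 ⊕ ⋀²𝔪 ⊕ 𝔰` -/

namespace FreeNil3

open ExtSq

section Construction

variable (k m : Type*) [Field k] [AddCommGroup m] [Module k m]

variable {m} in
/-- The element `2 x ⊗ (y ∧ z) + y ⊗ (x ∧ z) + z ⊗ (y ∧ x)` of `𝔪 ⊗ ⋀²𝔪`. -/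
def gen (x y z : m) : m ⊗[k] ⋀[k]^2 m :=
  (2 : k) • (x ⊗ₜ[k] wedge k y z) + y ⊗ₜ[k] wedge k x z + z ⊗ₜ[k] wedge k y x

/-- The subspace `𝔰` of `𝔪 ⊗ ⋀²𝔪` spanned by the elements
`2 x ⊗ (y ∧ z) + y ⊗ (x ∧ z) + z ⊗ (y ∧ x)`. -/
def sPart : Submodule k (m ⊗[k] ⋀[k]^2 m) :=
  Submodule.span k {t | ∃ x y z : m, t = gen k x y z}

/-- For fixed `x`, the linear map `y ∧ z ↦ (1/3) (2 x ⊗ (y ∧ z) + y ⊗ (x ∧ z) + z ⊗ (y ∧ x))`. -/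
def preBracket (x : m) : ⋀[k]^2 m →ₗ[k] m ⊗[k] ⋀[k]^2 m :=
  ExtSq.lift (LinearMap.mk₂ k (fun y z => (3⁻¹ : k) • gen k x y z)
    (fun y y' z => by
      simp only [gen, map_add, LinearMap.add_apply, TensorProduct.tmul_add,
        TensorProduct.add_tmul, smul_add]
      abel)
    (fun c y z => by
      simp only [gen, map_smul, LinearMap.smul_apply, TensorProduct.tmul_smul,
        ← TensorProduct.smul_tmul', smul_add]
      module)
    (fun y z z' => by
      simp only [gen, map_add, TensorProduct.tmul_add,
        TensorProduct.add_tmul, smul_add]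
      abel)
    (fun c y z => by
      simp only [gen, map_smul, TensorProduct.tmul_smul,
        ← TensorProduct.smul_tmul', smul_add]
      module))
    (fun y => by
      rw [LinearMap.mk₂_apply, gen, wedge_swap x y, wedge_self, TensorProduct.tmul_neg]
      simp)

variable {k m} in
theorem preBracket_wedge (x y z : m) :
    preBracket k m x (wedge k y z) = (3⁻¹ : k) • gen k x y z := by
  simp [preBracket]

variable {k m} in
theorem preBracket_mem (x : m) (u : ⋀[k]^2 m) : preBracket k m x u ∈ sPart k m := by
  have h : (sPart k m).mkQ ∘ₗ preBracket k m x = 0 := hom_ext fun y z => by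
    rw [LinearMap.comp_apply, preBracket_wedge, LinearMap.zero_apply, Submodule.mkQ_apply,
      Submodule.Quotient.mk_eq_zero]
    exact Submodule.smul_mem _ _ (Submodule.subset_span ⟨x, y, z, rfl⟩)
  have := LinearMap.congr_fun h u
  rwa [LinearMap.comp_apply, LinearMap.zero_apply, Submodule.mkQ_apply,
    Submodule.Quotient.mk_eq_zero] at this

/-- The product `𝔪 × ⋀²𝔪 → 𝔰`,
`[x, y ∧ z] = (2/3) x ⊗ (y ∧ z) + (1/3) y ⊗ (x ∧ z) + (1/3) z ⊗ (y ∧ x)`. -/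
def bracket₁₂ : m →ₗ[k] ⋀[k]^2 m →ₗ[k] sPart k m where
  toFun x := (preBracket k m x).codRestrict (sPart k m) (preBracket_mem x)
  map_add' x x' := hom_ext fun y z => by
    apply Subtype.ext
    simp only [LinearMap.codRestrict_apply, LinearMap.add_apply, Submodule.coe_add,
      preBracket_wedge, gen, map_add, TensorProduct.tmul_add, TensorProduct.add_tmul, smul_add]
    abel
  map_smul' c x := hom_ext fun y z => by
    apply Subtype.ext
    simp only [LinearMap.codRestrict_apply, LinearMap.smul_apply, Submodule.coe_smul,
      preBracket_wedge, gen, map_smul, TensorProduct.tmul_smul, ← TensorProduct.smul_tmul',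
      smul_add, RingHom.id_apply]
    module

variable {k m} in
theorem coe_bracket₁₂_wedge (x y z : m) :
    (bracket₁₂ k m x (wedge k y z) : m ⊗[k] ⋀[k]^2 m) =
      (2 / 3 : k) • (x ⊗ₜ[k] wedge k y z) + (1 / 3 : k) • (y ⊗ₜ[k] wedge k x z)
        + (1 / 3 : k) • (z ⊗ₜ[k] wedge k y x) := by
  change preBracket k m x (wedge k y z) = _
  rw [preBracket_wedge, gen]
  module

variable {k m} in
theorem bracket₁₂_jacobi (x y z : m) :
    bracket₁₂ k m x (wedge k y z) =
      bracket₁₂ k m y (wedge k x z) - bracket₁₂ k m z (wedge k x y) := by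
  apply Subtype.ext
  rw [Submodule.coe_sub]
  simp only [coe_bracket₁₂_wedge]
  rw [wedge_swap z y, wedge_swap y x]
  simp only [TensorProduct.tmul_neg]
  module

end Construction

end FreeNil3

/-- The vector space `𝒩(𝔪,3) = 𝔪 ⊕ ⋀²𝔪 ⊕ 𝔰`. -/
def FreeNil3 (k m : Type*) [Field k] [AddCommGroup m] [Module k m] : Type _ :=
  m × (⋀[k]^2 m) × FreeNil3.sPart k m

namespace FreeNil3

open ExtSq

variable {k m : Type*} [Field k] [AddCommGroup m] [Module k m]

instance : AddCommGroup (FreeNil3 k m) :=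
  inferInstanceAs (AddCommGroup (m × (⋀[k]^2 m) × sPart k m))

instance : Module k (FreeNil3 k m) :=
  inferInstanceAs (Module k (m × (⋀[k]^2 m) × sPart k m))

@[ext] theorem ext {a b : FreeNil3 k m} (h₁ : a.1 = b.1) (h₂ : a.2.1 = b.2.1)
    (h₃ : a.2.2 = b.2.2) : a = b :=
  Prod.ext h₁ (Prod.ext h₂ h₃)

variable (k m) in
/-- The projection of `𝒩(𝔪,3)` on `𝔪`. -/
def proj₁ : FreeNil3 k m →ₗ[k] m := LinearMap.fst k m ((⋀[k]^2 m) × sPart k m)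

variable (k m) in
/-- The projection of `𝒩(𝔪,3)` on `⋀²𝔪`. -/
def proj₂ : FreeNil3 k m →ₗ[k] ⋀[k]^2 m :=
  LinearMap.fst k (⋀[k]^2 m) (sPart k m) ∘ₗ LinearMap.snd k m ((⋀[k]^2 m) × sPart k m)

variable (k m) in
/-- The projection of `𝒩(𝔪,3)` on `𝔰`. -/
def proj₃ : FreeNil3 k m →ₗ[k] sPart k m :=
  LinearMap.snd k (⋀[k]^2 m) (sPart k m) ∘ₗ LinearMap.snd k m ((⋀[k]^2 m) × sPart k m)

theorem proj₁_apply (a : FreeNil3 k m) : proj₁ k m a = a.1 := rfl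
theorem proj₂_apply (a : FreeNil3 k m) : proj₂ k m a = a.2.1 := rfl
theorem proj₃_apply (a : FreeNil3 k m) : proj₃ k m a = a.2.2 := rfl

theorem ext_proj {a b : FreeNil3 k m} (h₁ : proj₁ k m a = proj₁ k m b)
    (h₂ : proj₂ k m a = proj₂ k m b) (h₃ : proj₃ k m a = proj₃ k m b) : a = b :=
  ext h₁ h₂ h₃

/-- The Lie product, with `[x, y] = x ∧ y` and `[x, y ∧ z]` as in `bracket₁₂` for
`x, y, z ∈ 𝔪`, all other products of homogeneous elements being zero. -/
instance : Bracket (FreeNil3 k m) (FreeNil3 k m) where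
  bracket a b := ((0 : m), wedge k a.1 b.1,
    bracket₁₂ k m a.1 b.2.1 - bracket₁₂ k m b.1 a.2.1)

theorem proj₁_lie (a b : FreeNil3 k m) : proj₁ k m ⁅a, b⁆ = 0 := rfl
theorem proj₂_lie (a b : FreeNil3 k m) :
    proj₂ k m ⁅a, b⁆ = wedge k (proj₁ k m a) (proj₁ k m b) := rfl
theorem proj₃_lie (a b : FreeNil3 k m) :
    proj₃ k m ⁅a, b⁆ = bracket₁₂ k m (proj₁ k m a) (proj₂ k m b)
      - bracket₁₂ k m (proj₁ k m b) (proj₂ k m a) := rfl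

instance : LieRing (FreeNil3 k m) where
  add_lie a b c := by
    apply ext_proj <;> simp only [proj₁_lie, proj₂_lie, proj₃_lie, map_add, LinearMap.add_apply,
      add_zero]
    abel
  lie_add a b c := by
    apply ext_proj <;> simp only [proj₁_lie, proj₂_lie, proj₃_lie, map_add, LinearMap.add_apply,
      add_zero]
    abel
  lie_self a := by
    apply ext_proj <;> simp only [proj₁_lie, proj₂_lie, proj₃_lie, map_zero, wedge_self, sub_self]
  leibniz_lie a b c := by
    apply ext_proj <;> simp only [proj₁_lie, proj₂_lie, proj₃_lie, map_add, map_zero,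
      LinearMap.zero_apply, add_zero, sub_zero]
    rw [bracket₁₂_jacobi]
    abel

instance : LieAlgebra k (FreeNil3 k m) where
  lie_smul c a b := by
    apply ext_proj <;> simp only [proj₁_lie, proj₂_lie, proj₃_lie, map_smul, LinearMap.smul_apply,
      smul_zero, smul_sub]

/-- The homogeneous components of `𝒩(𝔪,3)`: `𝔪`, `⋀²𝔪` and `𝔰` in degrees `1`, `2`, `3`. -/
def component : ℕ → Submodule k (FreeNil3 k m)
  | 1 => LinearMap.ker (proj₂ k m) ⊓ LinearMap.ker (proj₃ k m)
  | 2 => LinearMap.ker (proj₁ k m) ⊓ LinearMap.ker (proj₃ k m)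
  | 3 => LinearMap.ker (proj₁ k m) ⊓ LinearMap.ker (proj₂ k m)
  | _ => ⊥

section Action

variable {S : Type*} [LieRing S] [LieAlgebra k S] [LieRingModule S m] [LieModule k S m]

theorem lie_gen (a : S) (x y z : m) :
    ⁅a, gen k x y z⁆ = gen k ⁅a, x⁆ y z + gen k x ⁅a, y⁆ z + gen k x y ⁅a, z⁆ := by
  simp only [gen, lie_add, lie_smul, TensorProduct.LieModule.lie_tmul_right, lie_wedge,
    TensorProduct.tmul_add, smul_add]
  abel

variable (k S m) in
/-- `𝔰` as an `S`-submodule of `𝔪 ⊗ ⋀²𝔪`. -/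
def sLieSubmodule : LieSubmodule k S (m ⊗[k] ⋀[k]^2 m) where
  __ := sPart k m
  lie_mem := by
    intro a t ht
    change t ∈ Submodule.span k _ at ht
    change ⁅a, t⁆ ∈ sPart k m
    induction ht using Submodule.span_induction with
    | mem t ht =>
      obtain ⟨x, y, z, rfl⟩ := ht
      rw [lie_gen]
      exact Submodule.add_mem _ (Submodule.add_mem _ (Submodule.subset_span ⟨_, _, _, rfl⟩)
        (Submodule.subset_span ⟨_, _, _, rfl⟩)) (Submodule.subset_span ⟨_, _, _, rfl⟩)
    | zero => simp
    | add t t' _ _ h h' => rw [lie_add]; exact Submodule.add_mem _ h h'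
    | smul c t _ h => rw [lie_smul]; exact Submodule.smul_mem _ c h

instance : LieRingModule S (sPart k m) :=
  inferInstanceAs (LieRingModule S (sLieSubmodule k m S))

instance : LieModule k S (sPart k m) :=
  inferInstanceAs (LieModule k S (sLieSubmodule k m S))

theorem coe_lie_sPart (a : S) (t : sPart k m) :
    ((⁅a, t⁆ : sPart k m) : m ⊗[k] ⋀[k]^2 m) = ⁅a, (t : m ⊗[k] ⋀[k]^2 m)⁆ := rfl

/-- An `S`-module structure on `𝔪` extends to `𝒩(𝔪,3) = 𝔪 ⊕ ⋀²𝔪 ⊕ 𝔰` by the natural action on each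
summand. -/
instance : LieRingModule S (FreeNil3 k m) where
  bracket a u := (⁅a, u.1⁆, ⁅a, u.2.1⁆, ⁅a, u.2.2⁆)
  add_lie _ _ _ := ext (add_lie _ _ _) (add_lie _ _ _) (add_lie _ _ _)
  lie_add _ _ _ := ext (lie_add _ _ _) (lie_add _ _ _) (lie_add _ _ _)
  leibniz_lie _ _ _ := ext (leibniz_lie _ _ _) (leibniz_lie _ _ _) (leibniz_lie _ _ _)

instance : LieModule k S (FreeNil3 k m) where
  smul_lie _ _ _ := ext (smul_lie _ _ _) (smul_lie _ _ _) (smul_lie _ _ _)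
  lie_smul _ _ _ := ext (lie_smul _ _ _) (lie_smul _ _ _) (lie_smul _ _ _)

variable (k m S) in
/-- The projection on `⋀²𝔪` as a homomorphism of `S`-modules. -/
def lieProj₂ : FreeNil3 k m →ₗ⁅k, S⁆ ⋀[k]^2 m where
  __ := proj₂ k m
  map_lie' := rfl

variable (k m S) in
/-- The projection on `𝔰` as a homomorphism of `S`-modules. -/
def lieProj₃ : FreeNil3 k m →ₗ⁅k, S⁆ sPart k m where
  __ := proj₃ k m
  map_lie' := rfl

theorem lie_bracket₁₂ (a : S) (x : m) (u : ⋀[k]^2 m) :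
    ⁅a, bracket₁₂ k m x u⁆ = bracket₁₂ k m ⁅a, x⁆ u + bracket₁₂ k m x ⁅a, u⁆ := by
  have h : LieModule.toEnd k S (sPart k m) a ∘ₗ bracket₁₂ k m x =
      bracket₁₂ k m ⁅a, x⁆ + bracket₁₂ k m x ∘ₗ LieModule.toEnd k S (⋀[k]^2 m) a :=
    hom_ext fun y z => by
      apply Subtype.ext
      simp only [LinearMap.comp_apply, LinearMap.add_apply, LieModule.toEnd_apply_apply,
        lie_wedge, map_add, coe_lie_sPart, Submodule.coe_add, coe_bracket₁₂_wedge, lie_add,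
        lie_smul, TensorProduct.LieModule.lie_tmul_right, TensorProduct.tmul_add, smul_add]
      abel
  exact LinearMap.congr_fun h u

/-- `S` acts on `𝒩(𝔪,3)` by derivations. -/
theorem lie_lie_eq (a : S) (u v : FreeNil3 k m) :
    ⁅a, ⁅u, v⁆⁆ = ⁅⁅a, u⁆, v⁆ + ⁅u, ⁅a, v⁆⁆ := by
  refine ext ?_ ?_ ?_
  · change ⁅a, (0 : m)⁆ = 0 + 0
    simp
  · change ⁅a, wedge k u.1 v.1⁆ = wedge k ⁅a, u.1⁆ v.1 + wedge k u.1 ⁅a, v.1⁆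
    simp
  · change ⁅a, bracket₁₂ k m u.1 v.2.1 - bracket₁₂ k m v.1 u.2.1⁆ =
      (bracket₁₂ k m ⁅a, u.1⁆ v.2.1 - bracket₁₂ k m v.1 ⁅a, u.2.1⁆) +
        (bracket₁₂ k m u.1 ⁅a, v.2.1⁆ - bracket₁₂ k m ⁅a, v.1⁆ u.2.1)
    rw [lie_sub, lie_bracket₁₂, lie_bracket₁₂]
    abel

variable (k m S) in
/-- The term of index `j` of the lower central series of `𝒩(𝔪,3)` (`j = 0` is the whole algebra,
so that `𝒩(𝔪,3)³` is the one of index `2`), as an `S`-submodule. -/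
def lcs (j : ℕ) : LieSubmodule k S (FreeNil3 k m) where
  __ := (LieModule.lowerCentralSeries k (FreeNil3 k m) (FreeNil3 k m) j).toSubmodule
  lie_mem := by
    intro a u hu
    change u ∈ LieModule.lowerCentralSeries k (FreeNil3 k m) (FreeNil3 k m) j at hu
    change ⁅a, u⁆ ∈ LieModule.lowerCentralSeries k (FreeNil3 k m) (FreeNil3 k m) j
    induction j generalizing u with
    | zero => simp
    | succ j ih =>
      rw [LieModule.lowerCentralSeries_succ, ← LieSubmodule.mem_toSubmodule,
        LieSubmodule.lieIdeal_oper_eq_linear_span'] at hu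
      induction hu using Submodule.span_induction with
      | mem u hu =>
        obtain ⟨x, -, y, hy, rfl⟩ := hu
        rw [lie_lie_eq, LieModule.lowerCentralSeries_succ]
        exact add_mem (LieSubmodule.lie_mem_lie (LieSubmodule.mem_top _) hy)
          (LieSubmodule.lie_mem_lie (LieSubmodule.mem_top _) (ih hy))
      | zero => simp
      | add u v _ _ h h' => rw [lie_add]; exact add_mem h h'
      | smul c u _ h => rw [lie_smul]; exact SMulMemClass.smul_mem c h

variable (S) in
/-- An `S`-ideal of `𝒩(𝔪,3)`: an ideal that is also an `S`-submodule. -/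
def IsSIdeal (I : LieIdeal k (FreeNil3 k m)) : Prop :=
  ∀ (a : S), ∀ u ∈ I, ⁅a, u⁆ ∈ I

end Action

end FreeNil3

/-! ### Nilpotency index, free nilpotent Lie algebras, quasi-cyclic algebras -/

/-- `L` is `t`-nilpotent, i.e. nilpotent of index exactly `t`: `L^(t+1) = 0` and `L^t ≠ 0`.
Here `L^(j+1)` is `LieModule.lowerCentralSeries k L L j`. -/
def IsNilpotentOfIndex (k L : Type*) [Field k] [LieRing L] [LieAlgebra k L] (t : ℕ) : Prop :=
  ∀ j : ℕ, LieModule.lowerCentralSeries k L L j = ⊥ ↔ t ≤ j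

/-- An ideal `J` is homogeneous for a family `𝒜` of homogeneous components if it is the sum of
its intersections with the components. -/
def LieIdeal.IsHomogeneousFor {k L : Type*} [Field k] [LieRing L] [LieAlgebra k L]
    (𝒜 : ℕ → Submodule k L) (J : LieIdeal k L) : Prop :=
  J.toSubmodule = ⨆ j, J.toSubmodule ⊓ 𝒜 j

/-- The free `t`-nilpotent Lie algebra on `d` generators: the quotient of the free Lie algebra by
the term of its lower central series spanned by the brackets of length at least `t + 1`. -/
abbrev FreeNilpotentLie (k : Type*) [Field k] (d t : ℕ) : Type _ :=
  FreeLieAlgebra k (Fin d) ⧸ LieModule.lowerCentralSeries k (FreeLieAlgebra k (Fin d))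
    (FreeLieAlgebra k (Fin d)) t

namespace FreeNilpotentLie

/-- The left-normed bracket `[…[[x₀, x₁], x₂], …, xₙ]` of generators of the free Lie algebra. -/
def leftNormed (k : Type*) [Field k] {d : ℕ} (x : Fin d) (l : List (Fin d)) :
    FreeLieAlgebra k (Fin d) :=
  l.foldl (fun a i => ⁅a, FreeLieAlgebra.of k i⁆) (FreeLieAlgebra.of k x)

/-- The homogeneous component of degree `j` of the free `t`-nilpotent Lie algebra: the span of the
classes of the left-normed brackets of `j` generators. -/
def component (k : Type*) [Field k] (d t j : ℕ) : Submodule k (FreeNilpotentLie k d t) :=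
  Submodule.span k {a | ∃ (x : Fin d) (l : List (Fin d)), l.length + 1 = j ∧
    a = LieSubmodule.Quotient.mk (leftNormed k x l)}

end FreeNilpotentLie

/-- A quasi-cyclic nilpotent Lie algebra: a quotient of a free nilpotent Lie algebra by a
homogeneous ideal. -/
def IsQuasiCyclic (k L : Type*) [Field k] [LieRing L] [LieAlgebra k L] : Prop :=
  ∃ (d t : ℕ) (J : LieIdeal k (FreeNilpotentLie k d t)),
    J.IsHomogeneousFor (FreeNilpotentLie.component k d t) ∧
      Nonempty ((FreeNilpotentLie k d t ⧸ J) ≃ₗ⁅k⁆ L)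

end

attribute [local instance 100] LieRing.ofAssociativeRing

/-- The special linear Lie algebra `𝔰𝔩(𝔪)` of endomorphisms of trace zero. -/
noncomputable def specialLinear (k m : Type*) [Field k] [AddCommGroup m] [Module k m] :
    LieSubalgebra k (Module.End k m) where
  __ := LinearMap.ker (LinearMap.trace k m)
  lie_mem' := by
    intro f g _ _
    change LinearMap.trace k m ⁅f, g⁆ = 0
    rw [LieRing.of_associative_ring_bracket, map_sub, LinearMap.trace_mul_comm, sub_self]

/-! Since `I` lies in `⋀²𝔪 ⊕ 𝔰` and is not homogeneous, the sum `X` of `I ∩ ⋀²𝔪` and `I ∩ 𝔰` is a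
proper `S`-submodule of `I`. Complete reducibility (`LieSubmodule.complementedLattice_of_isKilling`,
proved through Casimir operators and Whitehead's first lemma) gives an irreducible `B ⊆ I` with `B ∩
X = 0`. An element of `B` killed by one of the two projections lies in `X`, so both projections are
injective on `B`, and the images are isomorphic to `B`.

If `ρ(S) = 𝔰𝔩(𝔪)` and `n = dim 𝔪`, some `a ∈ S` acts on `𝔪` as `1 - nE` with `E` an idempotent of
rank one. The eigenvalues of `a` are among `2, 2 - n` on `⋀²𝔪` and among `3, 3 - n, 3 - 2n` on `𝔪 ⊗
⋀²𝔪`. These sets are disjoint for `n ≥ 2`, so no nonzero `B` embeds in both.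

If `𝒩³` were irreducible, take `0 ≠ b ∈ B` and `0 ≠ x ∈ 𝔪`. By `eq_zero_of_bracket₁₂_eq_zero`, `[x,
b]` is a nonzero element of `I ∩ 𝒩³`, hence `𝒩³ ⊆ I` and the quotient could not have nilpotency
index 3. -/

section Weyl

open LieModule Module

variable {k S M : Type*} [Field k] [LieRing S] [LieAlgebra k S]
  [AddCommGroup M] [Module k M] [LieRingModule S M] [LieModule k S M]

/-! ### Cocycles and Casimir operators. -/

section Cocycle

variable (k S M) in
/-- A linear map `f : S → M` is a 1-cocycle if `f ⁅x, y⁆ = ⁅x, f y⁆ - ⁅y, f x⁆`. -/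
def IsLieOneCocycle (f : S →ₗ[k] M) : Prop := ∀ x y, f ⁅x, y⁆ = ⁅x, f y⁆ - ⁅y, f x⁆

-- Applied to these coboundaries, the Casimir identity for cocycles says that the Casimir operator
-- commutes with `S`.
variable (k S) in
theorem isLieOneCocycle_orbit (v : M) :
    IsLieOneCocycle k S M ((toEnd k S M : S →ₗ[k] End k M).flip v) := fun x y => by
  simp

end Cocycle

section Casimir

theorem isSymm_restrict_traceForm (W : Submodule k S) :
    LinearMap.BilinForm.IsSymm ((traceForm k S M).restrict W) :=
  ⟨fun x y => traceForm_comm k S M x y⟩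

variable {ι : Type*} [Fintype ι] [DecidableEq ι]

/-- Dual bases of an ideal with respect to an invariant form define an invariant tensor. -/
theorem sum_lie_dualBasis [FiniteDimensional k S] (J : LieIdeal k S)
    (hB : ((traceForm k S M).restrict J.toSubmodule).Nondegenerate) (b : Basis ι k J)
    (x : S) (g : S →ₗ[k] M) :
    ∑ i, ⁅⁅x, (b i : S)⁆, g (((traceForm k S M).restrict J.toSubmodule).dualBasis hB b i : J)⁆ =
      - ∑ i, ⁅(b i : S),
        g ⁅x, ((((traceForm k S M).restrict J.toSubmodule).dualBasis hB b i : J) : S)⁆⁆ := by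
  set β := (traceForm k S M).restrict J.toSubmodule with hβ
  have hsymm : β.IsSymm := isSymm_restrict_traceForm J.toSubmodule
  set b' := β.dualBasis hB b with hb'
  have h₁ (y : J) : (y : S) = ∑ j, traceForm k S M y (b' j) • (b j : S) := by
    have := (β.dualBasis hB b').sum_repr y
    rw [hb', LinearMap.BilinForm.dualBasis_dualBasis hB hsymm] at this
    conv_lhs => rw [← this]
    rw [AddSubmonoidClass.coe_finsetSum]
    refine Finset.sum_congr rfl fun j _ => ?_
    have h := LinearMap.BilinForm.dualBasis_repr_apply hB b' y j
    rw [hb', LinearMap.BilinForm.dualBasis_dualBasis hB hsymm] at h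
    rw [h]
    rfl
  have h₂ (y : J) : (y : S) = ∑ j, traceForm k S M y (b j) • (b' j : S) := by
    conv_lhs => rw [← b'.sum_repr y]
    rw [AddSubmonoidClass.coe_finsetSum]
    refine Finset.sum_congr rfl fun j _ => ?_
    rw [hb', LinearMap.BilinForm.dualBasis_repr_apply hB b y j]
    rfl
  have e₁ (i : ι) : ⁅x, (b i : S)⁆ = ∑ j, traceForm k S M ⁅x, (b i : S)⁆ (b' j) • (b j : S) :=
    h₁ ⟨⁅x, (b i : S)⁆, J.lie_mem (b i).2⟩
  have e₂ (i : ι) : ⁅x, (b' i : S)⁆ = ∑ j, traceForm k S M ⁅x, (b' i : S)⁆ (b j) • (b' j : S) :=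
    h₂ ⟨⁅x, (b' i : S)⁆, J.lie_mem (b' i).2⟩
  have l : ∀ i, ⁅⁅x, (b i : S)⁆, g (b' i)⁆ =
      ∑ j, traceForm k S M ⁅x, (b i : S)⁆ (b' j) • ⁅(b j : S), g (b' i)⁆ := fun i => by
    conv_lhs => rw [e₁ i]
    rw [sum_lie]
    simp
  have r : ∀ i, ⁅(b i : S), g ⁅x, (b' i : S)⁆⁆ =
      ∑ j, traceForm k S M ⁅x, (b' i : S)⁆ (b j) • ⁅(b i : S), g (b' j)⁆ := fun i => by
    conv_lhs => rw [e₂ i]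
    rw [map_sum, lie_sum]
    simp
  simp_rw [l, r]
  rw [Finset.sum_comm, ← Finset.sum_neg_distrib]
  refine Finset.sum_congr rfl fun i _ => ?_
  rw [← Finset.sum_neg_distrib]
  refine Finset.sum_congr rfl fun j _ => ?_
  -- By invariance of the form, the matrices of `ad x` in the two dual bases are negative transposes
  -- of each other.
  rw [traceForm_apply_lie_apply', traceForm_comm, neg_smul]

/-- The Casimir operator of an ideal on which the trace form is nondegenerate: it turns cocycles
into coboundaries, and its trace is the dimension of the ideal. -/
theorem exists_casimir [FiniteDimensional k S] (J : LieIdeal k S)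
    (hB : ((traceForm k S M).restrict J.toSubmodule).Nondegenerate) :
    ∃ c : End k M, LinearMap.trace k M c = (finrank k J : k) ∧
      (∀ (x : S) (v : M), ⁅x, c v⁆ = c ⁅x, v⁆) ∧
      ∀ f, IsLieOneCocycle k S M f → ∃ v : M, ∀ x, ⁅x, v⁆ = c (f x) := by
  classical
  set β := (traceForm k S M).restrict J.toSubmodule with hβ
  have hsymm : β.IsSymm := isSymm_restrict_traceForm J.toSubmodule
  let b := Module.finBasis k J
  let b' := β.dualBasis hB b
  let c : End k M := ∑ i, toEnd k S M (b i) ∘ₗ toEnd k S M (b' i)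
  have hc (v : M) : c v = ∑ i, ⁅(b i : S), ⁅(b' i : S), v⁆⁆ := by
    simp [c]
  -- Moving `x` inside leaves `∑ bᵢ(x f(b'ᵢ) - f[x, b'ᵢ])`, and the cocycle rule turns the bracketed
  -- term into `b'ᵢ f(x)`.
  have key : ∀ f, IsLieOneCocycle k S M f → ∀ x, ⁅x, ∑ i, ⁅(b i : S), f (b' i)⁆⁆ = c (f x) := by
    intro f hf x
    rw [lie_sum, hc]
    simp_rw [leibniz_lie x, Finset.sum_add_distrib]
    rw [sum_lie_dualBasis J hB b x f, ← Finset.sum_neg_distrib, ← Finset.sum_add_distrib]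
    refine Finset.sum_congr rfl fun i _ => ?_
    change -⁅(b i : S), f ⁅x, (b' i : S)⁆⁆ + _ = _
    rw [hf x (b' i), lie_sub]
    abel
  refine ⟨c, ?_, fun x v => ?_, fun f hf => ⟨_, key f hf⟩⟩
  · have h (i) : LinearMap.trace k M (toEnd k S M (b i) ∘ₗ toEnd k S M (b' i)) = 1 := by
      have := LinearMap.BilinForm.apply_dualBasis_right hB hsymm b i i
      rw [if_pos rfl] at this
      exact this
    simp only [c, map_sum, h]
    simp
  · have := key _ (isLieOneCocycle_orbit k S v) x
    simp only [LinearMap.flip_apply, LieHom.coe_toLinearMap, toEnd_apply_apply] at this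
    rw [hc v, this]

end Casimir

/-! ### Irreducible modules: nondegenerate trace form and vanishing of the first cohomology. -/

section Irreducible

variable (k S M) in
/-- The radical of the trace form, as an ideal. -/
noncomputable def traceFormKer : LieIdeal k S where
  __ := LinearMap.ker (traceForm k S M)
  lie_mem := by
    intro x y hy
    change y ∈ LinearMap.ker _ at hy
    change ⁅x, y⁆ ∈ LinearMap.ker _
    rw [LinearMap.mem_ker] at hy ⊢
    ext z
    rw [traceForm_apply_lie_apply', hy]
    simp

theorem mem_traceFormKer {x : S} : x ∈ traceFormKer k S M ↔ traceForm k S M x = 0 := Iff.rfl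

theorem disjoint_killingCompl [FiniteDimensional k S] [LieAlgebra.IsKilling k S] {I : LieIdeal k S} {x : S}
    (h₁ : x ∈ I) (h₂ : x ∈ I.killingCompl) : x = 0 := by
  have := (LieIdeal.isCompl_killingCompl I).inf_eq_bot
  exact (LieSubmodule.eq_bot_iff _).mp this x ⟨h₁, h₂⟩

/-- Brackets of elements of the Killing complement of `[S, S]` lie in both that complement and `[S,
S]`, so it is an abelian ideal, hence zero. -/
theorem lie_top_top_eq_top [FiniteDimensional k S] [LieAlgebra.IsKilling k S] :
    ⁅(⊤ : LieIdeal k S), (⊤ : LieIdeal k S)⁆ = ⊤ := by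
  set D := ⁅(⊤ : LieIdeal k S), (⊤ : LieIdeal k S)⁆ with hD
  have hA : D.killingCompl = ⊥ := by
    have : IsLieAbelian D.killingCompl := by
      rw [LieSubmodule.lie_abelian_iff_lie_self_eq_bot, LieSubmodule.lie_eq_bot_iff]
      intro x hx y hy
      refine disjoint_killingCompl (I := D) ?_ (lie_mem_right k S _ x y hy)
      exact LieSubmodule.lie_mem_lie (LieSubmodule.mem_top x) (LieSubmodule.mem_top y)
    exact LieAlgebra.IsKilling.ideal_eq_bot_of_isLieAbelian _
  have := (LieIdeal.isCompl_killingCompl D).sup_eq_top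
  rwa [hA, sup_bot_eq] at this

variable [CharZero k]

/-- Cartan's criterion makes `[R, R]` act nilpotently, so by Engel it kills a nonzero vector. The
vectors killed by this ideal form an `S`-submodule, which irreducibility forces to be everything. -/
theorem lie_eq_zero_of_mem_lie_traceFormKer [FiniteDimensional k M] [LieModule.IsIrreducible k S M] {x : S}
    (hx : x ∈ ⁅traceFormKer k S M, traceFormKer k S M⁆) (v : M) : ⁅x, v⁆ = 0 := by
  set R := traceFormKer k S M with hR
  have htf : traceForm k R M = 0 := by
    ext y z
    have := LinearMap.congr_fun (mem_traceFormKer.mp y.2) (z : S)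
    exact this
  have hnil := isNilpotent_derivedSeries_of_traceForm_eq_zero htf
  have : Nontrivial M := LieModule.nontrivial_of_isIrreducible k S M
  let N : LieSubmodule k S M :=
    { carrier := {v | ∀ x ∈ ⁅R, R⁆, ⁅x, v⁆ = 0}
      add_mem' := fun ha hb x hx => by rw [lie_add, ha x hx, hb x hx, add_zero]
      zero_mem' := fun x _ => lie_zero x
      smul_mem' := fun c v hv x hx => by rw [lie_smul, hv x hx, smul_zero]
      lie_mem := fun {y v} hv x hx => by
        rw [leibniz_lie, hv x hx, lie_zero, add_zero]
        exact hv _ (lie_mem_left k S ⁅R, R⁆ x y hx) }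
  have hN : N ≠ ⊥ := by
    have := nontrivial_max_triv_of_isNilpotent k (LieAlgebra.derivedSeries k R 1) M
    obtain ⟨w, hw⟩ := exists_ne (0 : maxTrivSubmodule k (LieAlgebra.derivedSeries k R 1) M)
    intro h
    refine hw (Subtype.ext ((LieSubmodule.eq_bot_iff N).mp h w ?_))
    intro x hx
    have hxR : x ∈ R := LieSubmodule.lie_le_left R R hx
    refine w.2 ⟨⟨x, hxR⟩, ?_⟩
    rw [LieIdeal.derivedSeries_eq_derivedSeriesOfIdeal_comap]
    simpa using hx
  have hT : N = ⊤ := (IsSimpleOrder.eq_bot_or_eq_top N).resolve_left hN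
  have : v ∈ N := hT ▸ LieSubmodule.mem_top v
  exact this x hx

variable [FiniteDimensional k S]

/-- The trace form of an irreducible module is nondegenerate on the complement of the kernel of
the representation. -/
theorem nondegenerate_traceForm_restrict [FiniteDimensional k M] [LieAlgebra.IsKilling k S]
    [LieModule.IsIrreducible k S M] :
    ((traceForm k S M).restrict (toEnd k S M).ker.killingCompl.toSubmodule).Nondegenerate := by
  set K := (toEnd k S M).ker with hK
  set J := K.killingCompl with hJ
  have hA : traceFormKer k S M ⊓ J = ⊥ := by
    have : IsLieAbelian (traceFormKer k S M ⊓ J : LieIdeal k S) := by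
      rw [LieSubmodule.lie_abelian_iff_lie_self_eq_bot, LieSubmodule.lie_eq_bot_iff]
      intro x hx y hy
      refine disjoint_killingCompl (I := K) ?_ (lie_mem_right k S J x y hy.2)
      rw [hK, LieHom.mem_ker]
      ext v
      exact lie_eq_zero_of_mem_lie_traceFormKer (LieSubmodule.lie_mem_lie hx.1 hy.1) v
    exact LieAlgebra.IsKilling.ideal_eq_bot_of_isLieAbelian _
  have hsymm := isSymm_restrict_traceForm (M := M) J.toSubmodule
  refine hsymm.isRefl.nondegenerate_iff_separatingLeft.mpr ?_
  intro x hx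
  refine Subtype.ext ((LieSubmodule.eq_bot_iff _).mp hA x ⟨?_, x.2⟩)
  change (x : S) ∈ traceFormKer k S M
  rw [mem_traceFormKer]
  ext z
  -- Orthogonality to `J` suffices for orthogonality to all of `S`, because `K` acts by zero.
  have hz : z ∈ K ⊔ J := by
    rw [(LieIdeal.isCompl_killingCompl K).sup_eq_top]
    exact LieSubmodule.mem_top z
  obtain ⟨a, ha, b, hb, rfl⟩ := (LieSubmodule.mem_sup _ _ _).mp hz
  have ha0 : toEnd k S M a = 0 := LieHom.mem_ker.mp ha
  have hb0 : traceForm k S M x b = 0 := hx ⟨b, hb⟩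
  rw [map_add, hb0, traceForm_apply_apply, ha0]
  simp

/-- On a trivial module a cocycle kills all brackets, and `S` is perfect. Otherwise the Casimir
operator has nonzero trace, so by Schur's argument it is injective, hence invertible, and can be
cancelled from `x v = c (f x)`. -/
theorem exists_eq_lie_of_isIrreducible [FiniteDimensional k M] [LieAlgebra.IsKilling k S]
    [LieModule.IsIrreducible k S M] {f : S →ₗ[k] M} (hf : IsLieOneCocycle k S M f) :
    ∃ v : M, ∀ x, f x = ⁅x, v⁆ := by
  set K := (toEnd k S M).ker with hK
  by_cases hJ : K.killingCompl = ⊥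
  · have hKtop : K = ⊤ := by
      have := (LieIdeal.isCompl_killingCompl K).sup_eq_top
      rwa [hJ, sup_bot_eq] at this
    have htriv (x : S) (v : M) : ⁅x, v⁆ = 0 := by
      have : x ∈ K := hKtop ▸ LieSubmodule.mem_top x
      exact LinearMap.congr_fun (LieHom.mem_ker.mp this) v
    refine ⟨0, fun x => ?_⟩
    have hx : x ∈ (⁅(⊤ : LieIdeal k S), (⊤ : LieIdeal k S)⁆ : LieIdeal k S).toSubmodule := by
      rw [lie_top_top_eq_top]
      trivial
    rw [LieSubmodule.lieIdeal_oper_eq_linear_span'] at hx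
    rw [lie_zero]
    induction hx using Submodule.span_induction with
    | mem u hu =>
      obtain ⟨x, -, y, -, rfl⟩ := hu
      rw [hf, htriv, htriv, sub_zero]
    | zero => simp
    | add u v _ _ h h' => rw [map_add, h, h', add_zero]
    | smul c u _ h => rw [map_smul, h, smul_zero]
  · obtain ⟨c, htr, hc, hcob⟩ := exists_casimir (M := M) K.killingCompl
      nondegenerate_traceForm_restrict
    have hker : LinearMap.ker c = ⊥ := by
      let N : LieSubmodule k S M :=
        { LinearMap.ker c with
          lie_mem := fun {x v} hv => by
            change c ⁅x, v⁆ = 0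
            rw [← hc, (LinearMap.mem_ker.mp hv : c v = 0), lie_zero] }
      rcases IsSimpleOrder.eq_bot_or_eq_top N with h | h
      · exact congrArg LieSubmodule.toSubmodule h
      · exfalso
        have hc0 : c = 0 := by
          ext v
          have : v ∈ N := h ▸ LieSubmodule.mem_top v
          exact this
        rw [hc0, map_zero] at htr
        have h0 : finrank k K.killingCompl = 0 := by exact_mod_cast htr.symm
        refine hJ ((LieSubmodule.toSubmodule_eq_bot _).mp ?_)
        exact Submodule.finrank_eq_zero.mp h0
    obtain ⟨v, hv⟩ := hcob f hf
    have hsurj : Function.Surjective c :=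
      LinearMap.surjective_of_injective (LinearMap.ker_eq_bot.mp hker)
    obtain ⟨w, rfl⟩ := hsurj v
    refine ⟨w, fun x => LinearMap.ker_eq_bot.mp hker ?_⟩
    rw [← hv, hc]

end Irreducible

/-! ### Whitehead's lemma and Weyl's theorem. -/

/-- **Whitehead's first lemma**: in characteristic zero, 1-cocycles of a finite-dimensional
semisimple Lie algebra in a finite-dimensional module are coboundaries. -/
theorem IsLieOneCocycle.exists_eq_lie [CharZero k] [FiniteDimensional k S]
    [LieAlgebra.IsKilling k S] [FiniteDimensional k M] {f : S →ₗ[k] M}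
    (hf : IsLieOneCocycle k S M f) : ∃ v : M, ∀ x, f x = ⁅x, v⁆ := by
  induction hn : finrank k M using Nat.strong_induction_on generalizing M with
  | _ n ih =>
  subst hn
  rcases subsingleton_or_nontrivial M with hM | hM
  · exact ⟨0, fun x => Subsingleton.elim _ _⟩
  by_cases hirr : LieModule.IsIrreducible k S M
  · exact exists_eq_lie_of_isIrreducible hf
  obtain ⟨N, hN⟩ : ∃ N : LieSubmodule k S M, ¬ (N ≠ ⊥ → N = ⊤) := by
    by_contra! h
    exact hirr (LieModule.IsIrreducible.mk h)
  push Not at hN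
  obtain ⟨hbot, htop⟩ := hN
  have hlt : finrank k N < finrank k M :=
    Submodule.finrank_lt (s := N.toSubmodule) (by simpa [lt_top_iff_ne_top] using htop)
  have hltq : finrank k (M ⧸ N) < finrank k M := by
    have h₁ := Submodule.finrank_quotient_add_finrank N.toSubmodule
    have h₂ : 0 < finrank k N.toSubmodule := by
      rw [Nat.pos_iff_ne_zero, ne_eq, Submodule.finrank_eq_zero]
      simpa using hbot
    change finrank k (M ⧸ N.toSubmodule) < _
    omega
  let q : M →ₗ⁅k, S⁆ M ⧸ N := LieSubmodule.Quotient.mk' N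
  obtain ⟨v', hv'⟩ := ih _ hltq (M := M ⧸ N) (f := (q : M →ₗ[k] M ⧸ N) ∘ₗ f)
    (fun x y => by
      change q (f ⁅x, y⁆) = ⁅x, q (f y)⁆ - ⁅y, q (f x)⁆
      rw [hf, map_sub, LieModuleHom.map_lie, LieModuleHom.map_lie]) rfl
  obtain ⟨v, rfl⟩ := LieSubmodule.Quotient.surjective_mk' N v'
  -- Subtracting the coboundary of a lift of the solution in `M ⧸ N` leaves a cocycle with values in
  -- `N`, where induction applies again.
  let g : S →ₗ[k] M := f - (toEnd k S M : S →ₗ[k] End k M).flip v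
  have hg (x : S) : g x = f x - ⁅x, v⁆ := rfl
  have hgN (x : S) : g x ∈ N.toSubmodule := by
    have : q (f x) = ⁅x, q v⁆ := hv' x
    rw [← LieModuleHom.map_lie] at this
    rw [hg]
    exact (Submodule.Quotient.eq N.toSubmodule).mp this
  obtain ⟨w, hw⟩ := ih _ hlt (M := N) (f := g.codRestrict N.toSubmodule hgN)
    (fun x y => by
      apply Subtype.ext
      change g ⁅x, y⁆ = ⁅x, g y⁆ - ⁅y, g x⁆
      simp only [hg, hf x y, lie_sub, lie_lie]
      abel) rfl
  refine ⟨v + w, fun x => ?_⟩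
  have : g x = ⁅x, (w : M)⁆ := congrArg Subtype.val (hw x)
  rw [lie_add, ← this, hg]
  abel

/-- **Weyl's theorem** on complete reducibility. -/
theorem LieSubmodule.complementedLattice_of_isKilling [CharZero k] [FiniteDimensional k S]
    [LieAlgebra.IsKilling k S] [FiniteDimensional k M] :
    ComplementedLattice (LieSubmodule k S M) where
  exists_isCompl N := by
    obtain ⟨p, hp⟩ := N.toSubmodule.subtype.exists_leftInverse_of_injective N.toSubmodule.ker_subtype
    have hpN (v : N) : p v = v := LinearMap.congr_fun hp v
    let π : M →ₗ[k] N := p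
    let H : LieSubmodule k S (M →ₗ[k] N) :=
      { carrier := {φ | ∀ v ∈ N, φ v = 0}
        add_mem' := fun ha hb v hv => by
          rw [LinearMap.add_apply, ha v hv, hb v hv, add_zero]
        zero_mem' := fun v _ => rfl
        smul_mem' := fun c φ hφ v hv => by rw [LinearMap.smul_apply, hφ v hv, smul_zero]
        lie_mem := fun {x φ} hφ v hv => by
          change φ ∈ {φ : M →ₗ[k] N | ∀ v ∈ N, φ v = 0} at hφ
          rw [LieHom.lie_apply, hφ v hv, hφ _ (N.lie_mem hv), lie_zero, sub_zero] }
    let g : S →ₗ[k] (M →ₗ[k] N) := (toEnd k S (M →ₗ[k] N) : S →ₗ[k] End k (M →ₗ[k] N)).flip π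
    have hg (x : S) : g x = ⁅x, π⁆ := rfl
    -- As `π` is the identity on `N`, each `[x, π]` vanishes on `N`. Since `π` itself need not lie
    -- in `H`, Whitehead's lemma is needed to find `w ∈ H` with the same coboundary; then `π - w` is
    -- an equivariant projection onto `N`.
    have hgH (x : S) : g x ∈ H.toSubmodule := by
      intro v hv
      rw [hg, LieHom.lie_apply, hpN ⟨v, hv⟩, hpN ⟨⁅x, v⁆, N.lie_mem hv⟩, sub_eq_zero]
      rfl
    obtain ⟨w, hw⟩ := IsLieOneCocycle.exists_eq_lie (M := H) (f := g.codRestrict H.toSubmodule hgH)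
      (fun x y => by
        apply Subtype.ext
        change g ⁅x, y⁆ = ⁅x, g y⁆ - ⁅y, g x⁆
        simp [hg])
    have hw' (x : S) : ⁅x, π⁆ = ⁅x, (w : M →ₗ[k] N)⁆ := congrArg Subtype.val (hw x)
    let ψ : M →ₗ[k] N := π - w
    have hψ (x : S) (v : M) : ψ ⁅x, v⁆ = ⁅x, ψ v⁆ := by
      have : ⁅x, ψ⁆ = 0 := by rw [lie_sub, hw', sub_self]
      have := LinearMap.congr_fun this v
      rw [LieHom.lie_apply, LinearMap.zero_apply, sub_eq_zero] at this
      exact this.symm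
    have hψN (v : N) : ψ v = v := by
      change π v - (w : M →ₗ[k] N) v = v
      rw [w.2 v v.2, sub_zero]
      exact hpN v
    let C : LieSubmodule k S M :=
      { LinearMap.ker ψ with
        lie_mem := fun {x v} hv => by
          change ψ ⁅x, v⁆ = 0
          rw [hψ, (LinearMap.mem_ker.mp hv : ψ v = 0), lie_zero] }
    refine ⟨C, ?_⟩
    rw [← LieSubmodule.isCompl_toSubmodule]
    exact LinearMap.isCompl_of_proj hψN

end Weyl

/-! ### Irreducible submodules avoiding a given submodule. -/

section LieSubmoduleLattice

variable {k S V W : Type*} [Field k] [LieRing S] [LieAlgebra k S]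
  [AddCommGroup V] [Module k V] [LieRingModule S V] [LieModule k S V]
  [AddCommGroup W] [Module k W] [LieRingModule S W] [LieModule k S W]

/-- A Lie submodule disjoint from the kernel of a homomorphism is equivalent to its image. -/
noncomputable def LieSubmodule.equivMapOfDisjointKer (B : LieSubmodule k S V) (f : V →ₗ⁅k, S⁆ W)
    (h : ∀ x ∈ B, f x = 0 → x = 0) : B ≃ₗ⁅k, S⁆ B.map f where
  __ := LinearEquiv.ofBijective
    ((f : V →ₗ[k] W).restrict (p := B.toSubmodule) (q := (B.map f).toSubmodule)
      fun _ hx => LieSubmodule.mem_map_of_mem hx)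
    ⟨(injective_iff_map_eq_zero _).mpr fun x hx => Subtype.ext (h x x.2 (congrArg Subtype.val hx)),
      fun ⟨_, x, hx, hy⟩ => ⟨⟨x, hx⟩, Subtype.ext hy⟩⟩
  map_lie' {a x} := Subtype.ext (f.map_lie a x)

theorem LieSubmodule.isIrreducible_of_isAtom {k S V : Type*} [CommRing k] [LieRing S]
    [AddCommGroup V] [Module k V] [LieRingModule S V] {B : LieSubmodule k S V} (hB : IsAtom B) :
    LieModule.IsIrreducible k S B := by
  have : Nontrivial B := (LieSubmodule.nontrivial_iff_ne_bot k S V).mpr hB.1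
  refine LieModule.IsIrreducible.mk fun N hN => ?_
  have hle : N.map B.incl ≤ B := by
    rintro _ ⟨x, -, rfl⟩
    exact x.2
  rcases hB.le_iff.mp hle with h | h
  · refine absurd ((LieSubmodule.eq_bot_iff N).mpr fun x hx => ?_) hN
    exact Subtype.ext ((LieSubmodule.eq_bot_iff _).mp h _ (LieSubmodule.mem_map_of_mem hx))
  · refine eq_top_iff.mpr fun x _ => ?_
    have hx : (x : V) ∈ N.map B.incl := by
      rw [h]
      exact x.2
    obtain ⟨y, hy, hyx⟩ := hx
    have : y = x := Subtype.ext hyx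
    exact this ▸ hy

/-- By the modular law a complement of `X` meets `I` nontrivially; any atom below this intersection
serves. -/
theorem LieSubmodule.exists_isIrreducible_disjoint [CharZero k] [FiniteDimensional k S]
    [LieAlgebra.IsKilling k S] [FiniteDimensional k V] {X I : LieSubmodule k S V} (h : X < I) :
    ∃ B ≤ I, LieModule.IsIrreducible k S B ∧ Disjoint B X := by
  have := LieSubmodule.complementedLattice_of_isKilling (k := k) (S := S) (M := V)
  obtain ⟨C, hC⟩ := exists_isCompl X
  have hne : C ⊓ I ≠ ⊥ := fun h0 => by
    have : X ⊔ C ⊓ I = I := by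
      rw [← sup_inf_assoc_of_le C h.le, hC.sup_eq_top, top_inf_eq]
    rw [h0, sup_bot_eq] at this
    exact h.ne this
  obtain ⟨B, hB, hle⟩ := (IsAtomic.eq_bot_or_exists_atom_le (C ⊓ I)).resolve_left hne
  exact ⟨B, hle.trans inf_le_right, isIrreducible_of_isAtom hB,
    hC.disjoint.symm.mono_left (hle.trans inf_le_left)⟩

end LieSubmoduleLattice

/-! ### Contractions, and injectivity of the bracket with a nonzero element of `𝔪`. -/

namespace ExtSq

variable {k m : Type*} [Field k] [AddCommGroup m] [Module k m]

/-- Contraction `y ∧ z ↦ φ y • z - φ z • y` with a linear form. -/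
noncomputable def contract (φ : m →ₗ[k] k) : ⋀[k]^2 m →ₗ[k] m :=
  lift (LinearMap.mk₂ k (fun y z => φ y • z - φ z • y)
    (fun y y' z => by simp only [map_add]; module)
    (fun c y z => by simp only [map_smul, smul_eq_mul]; module)
    (fun y z z' => by simp only [map_add]; module)
    (fun c y z => by simp only [map_smul, smul_eq_mul]; module))
    (fun y => by simp)

@[simp] theorem contract_wedge (φ : m →ₗ[k] k) (y z : m) :
    contract φ (wedge k y z) = φ y • z - φ z • y := by
  simp [contract]

theorem apply_contract (φ : m →ₗ[k] k) (u : ⋀[k]^2 m) : φ (contract φ u) = 0 := by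
  have : φ ∘ₗ contract φ = 0 := hom_ext fun y z => by
    simp [mul_comm]
  exact LinearMap.congr_fun this u

end ExtSq

namespace FreeNil3

open ExtSq

variable {k m : Type*} [Field k] [AddCommGroup m] [Module k m]

theorem lift_smul_bracket₁₂ (φ : m →ₗ[k] k) (x : m) (u : ⋀[k]^2 m) :
    TensorProduct.lift (LinearMap.lsmul k (⋀[k]^2 m) ∘ₗ φ)
      (bracket₁₂ k m x u : m ⊗[k] ⋀[k]^2 m) =
      (2 / 3 * φ x : k) • u + (1 / 3 : k) • wedge k x (contract φ u) := by
  have : TensorProduct.lift (LinearMap.lsmul k (⋀[k]^2 m) ∘ₗ φ) ∘ₗ (sPart k m).subtype ∘ₗ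
      bracket₁₂ k m x = (2 / 3 * φ x : k) • LinearMap.id +
        (1 / 3 : k) • (wedge k x ∘ₗ contract φ) := hom_ext fun y z => by
    simp only [LinearMap.comp_apply, Submodule.subtype_apply, coe_bracket₁₂_wedge, map_add,
      map_smul, TensorProduct.lift.tmul, LinearMap.lsmul_apply, LinearMap.add_apply,
      LinearMap.smul_apply, LinearMap.id_apply, contract_wedge, map_sub]
    rw [wedge_swap y x]
    module
  exact LinearMap.congr_fun this u

/-- With `φ x = 1` and `w` the contraction of `u` by `φ`, applying `φ` to the first tensor factor of
`[x, u]` gives `(2/3) u + (1/3) x ∧ w`. Contracting once more gives `w`, because `φ w = 0`. Hence `w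
= 0`, and then `u = 0`. -/
theorem eq_zero_of_bracket₁₂_eq_zero [CharZero k] {x : m} (hx : x ≠ 0) {u : ⋀[k]^2 m}
    (h : bracket₁₂ k m x u = 0) : u = 0 := by
  obtain ⟨φ, hφ⟩ := Module.Projective.exists_dual_eq_one k hx
  have h₁ := lift_smul_bracket₁₂ φ x u
  rw [h, Submodule.coe_zero, map_zero, hφ] at h₁
  have h₂ := congrArg (contract φ) h₁
  simp only [map_zero, map_add, map_smul, contract_wedge, hφ, apply_contract] at h₂
  have h₃ : contract φ u = 0 := by linear_combination (norm := module) -h₂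
  rw [h₃, map_zero] at h₁
  linear_combination (norm := module) (-(3 / 2) : k) • h₁

theorem proj₁_eq_zero {u : FreeNil3 k m}
    (hu : u ∈ LieModule.lowerCentralSeries k (FreeNil3 k m) (FreeNil3 k m) 1) :
    proj₁ k m u = 0 := by
  rw [LieModule.lowerCentralSeries_succ, ← LieSubmodule.mem_toSubmodule,
    LieSubmodule.lieIdeal_oper_eq_linear_span'] at hu
  induction hu using Submodule.span_induction with
  | mem u hu =>
    obtain ⟨x, -, y, -, rfl⟩ := hu
    exact proj₁_lie x y
  | zero => simp
  | add u v _ _ h h' => rw [map_add, h, h', add_zero]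
  | smul c u _ h => rw [map_smul, h, smul_zero]

instance [FiniteDimensional k m] : FiniteDimensional k (FreeNil3 k m) :=
  inferInstanceAs (FiniteDimensional k (m × (⋀[k]^2 m) × sPart k m))

end FreeNil3

/-! ### Eigenvalues of `1 - nE` on `⋀²𝔪` and on `𝔪 ⊗ ⋀²𝔪`. -/

section Spectrum

open ExtSq LieModule

variable {k m : Type*} [Field k] [AddCommGroup m] [Module k m]

/-- The cross term `2 Ey ∧ Ez` in the square vanishes because `E` has rank one. -/
theorem ExtSq.der_smulRight_idem {φ : m →ₗ[k] k} {v : m} (h : φ v = 1) (w : ⋀[k]^2 m) :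
    der (φ.smulRight v) (der (φ.smulRight v) w) = der (φ.smulRight v) w := by
  have : der (φ.smulRight v) ∘ₗ der (φ.smulRight v) = der (φ.smulRight v) := hom_ext fun y z => by
    simp [h]
  exact LinearMap.congr_fun this w

variable {S : Type*} [LieRing S] [LieAlgebra k S] [LieRingModule S m] [LieModule k S m]

theorem ExtSq.lie_eq_of_toEnd_eq {a : S} {E : Module.End k m} {n : k}
    (ha : toEnd k S m a = 1 - n • E) (w : ⋀[k]^2 m) :
    ⁅a, w⁆ = (2 : k) • w - n • der E w := by
  have : der (toEnd k S m a) = (2 : k) • LinearMap.id - n • der E := hom_ext fun y z => by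
    rw [ha]
    simp only [der_wedge, LinearMap.sub_apply, LinearMap.smul_apply, Module.End.one_apply,
      LinearMap.id_apply, map_sub, map_smul]
    module
  exact LinearMap.congr_fun this w

/-- The polynomial is `(X - 2)(X - (2 - n))`, and `a` acts as `2 - nD` with `D` idempotent. -/
theorem ExtSq.quadratic_lie_eq_zero {a : S} {φ : m →ₗ[k] k} {v : m} (h : φ v = 1) {n : k}
    (ha : toEnd k S m a = 1 - n • φ.smulRight v) (w : ⋀[k]^2 m) :
    ⁅a, ⁅a, w⁆⁆ + (n - 4) • ⁅a, w⁆ + (4 - 2 * n) • w = 0 := by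
  simp only [lie_eq_of_toEnd_eq ha, map_sub, map_smul, der_smulRight_idem h]
  module

/-- The sum of two commuting idempotents is a root of `X (X - 1) (X - 2)`. -/
theorem add_mul_sub_mul_sub_eq_zero {A : Type*} [Ring A] {P Q : A} (hP : P * P = P)
    (hQ : Q * Q = Q) (h : Commute P Q) :
    (P + Q) * (P + Q) * (P + Q) - 3 * ((P + Q) * (P + Q)) + 2 * (P + Q) = 0 := by
  have h' : Q * P = P * Q := h.eq.symm
  have h₂ : (P + Q) * (P + Q) = P + Q + 2 * (P * Q) := by
    rw [add_mul, mul_add, mul_add, hP, hQ, h']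
    noncomm_ring
  have h₃ : P * Q * P = P * Q := by rw [mul_assoc, h', ← mul_assoc, hP]
  have h₄ : P * Q * Q = P * Q := by rw [mul_assoc, hQ]
  rw [h₂, add_mul, h₂, mul_assoc 2, mul_add, h₃, h₄]
  noncomm_ring

/-- The polynomial `p` applied to `T` is `(X - 2)(X - (2 - n))` evaluated at `3 - nT`. As `T` is a
root of `X(X - 1)(X - 2)`, only the values `p(0) = 1 + n`, `p(1) = 1 - n` and `p(2) = (1 - n)(1 -
2n)` matter, all nonzero for `n ≥ 2`. -/
theorem eq_zero_of_quadratic_eq_zero [CharZero k] {V : Type*} [AddCommGroup V] [Module k V]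
    {T : Module.End k V} {n : ℕ} (hn : 2 ≤ n)
    (hT : ∀ t, T (T (T t)) = (3 : k) • T (T t) - (2 : k) • T t) {t : V}
    (ht : (1 + n : k) • t - (n ^ 2 + 2 * n : k) • T t + (n ^ 2 : k) • T (T t) = 0) : t = 0 := by
  have e₁ := congrArg T ht
  have e₂ := congrArg T e₁
  simp only [map_add, map_sub, map_smul, map_zero, hT] at e₁ e₂
  have c₀ : (1 + n : k) ≠ 0 := by
    have : ((1 + n : ℕ) : k) ≠ 0 := Nat.cast_ne_zero.mpr (by omega)
    exact_mod_cast this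
  have c₁ : (1 - n : k) ≠ 0 := fun h => by
    have : ((1 : ℕ) : k) = (n : k) := by linear_combination h
    have := Nat.cast_injective this
    omega
  have c₂ : (1 - 2 * n : k) ≠ 0 := fun h => by
    have : ((1 : ℕ) : k) = ((2 * n : ℕ) : k) := by push_cast; linear_combination h
    have := Nat.cast_injective this
    omega
  -- Multiplying `p(T) t = 0` by `(T - 1)(T - 2)` isolates `p(0)`; below, the factor `T - 2`
  -- isolates `p(1)`, and what remains is `p(2) t = 0`.
  have s₂ : T (T t) - (3 : k) • T t + (2 : k) • t = 0 := by
    refine (smul_eq_zero.mp (?_ : (1 + n : k) • (_ : V) = 0)).resolve_left c₀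
    linear_combination (norm := module) e₂ - (3 : k) • e₁ + (2 : k) • ht
  have s₁ : T t - (2 : k) • t = 0 := by
    refine (smul_eq_zero.mp (?_ : (1 - n : k) • (_ : V) = 0)).resolve_left c₁
    linear_combination (norm := module) e₁ - (2 : k) • ht + (2 * n : k) • s₂
  refine (smul_eq_zero.mp (?_ : ((1 - n) * (1 - 2 * n) : k) • t = 0)).resolve_left
    (mul_ne_zero c₁ c₂)
  linear_combination (norm := module) ht
    + (n ^ 2 + 2 * n - 3 * n ^ 2 : k) • s₁ - (n ^ 2 : k) • s₂

/-- On the tensor product `a` acts as `3 - n(P + Q)`, with `P` and `Q` the commuting idempotents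
induced by `E` on the two factors. -/
theorem eq_zero_of_quadratic_lie_eq_zero [CharZero k] {a : S} {φ : m →ₗ[k] k} {v : m}
    (h : φ v = 1) {n : ℕ} (hn : 2 ≤ n) (ha : toEnd k S m a = 1 - (n : k) • φ.smulRight v)
    {t : m ⊗[k] ⋀[k]^2 m}
    (ht : ⁅a, ⁅a, t⁆⁆ + (n - 4 : k) • ⁅a, t⁆ + (4 - 2 * n : k) • t = 0) : t = 0 := by
  set E := φ.smulRight v with hE
  let P : Module.End k (m ⊗[k] ⋀[k]^2 m) := LinearMap.rTensor (⋀[k]^2 m) E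
  let Q : Module.End k (m ⊗[k] ⋀[k]^2 m) := LinearMap.lTensor m (der E)
  have hP : P * P = P := TensorProduct.ext' fun x w => by
    simp [P, hE, h]
  have hQ : Q * Q = Q := TensorProduct.ext' fun x w => by
    simp [Q, hE, der_smulRight_idem h]
  have hPQ : Commute P Q := TensorProduct.ext' fun x w => by
    simp [P, Q]
  have hact (t : m ⊗[k] ⋀[k]^2 m) : ⁅a, t⁆ = (3 : k) • t - (n : k) • (P + Q) t := by
    have : toEnd k S (m ⊗[k] ⋀[k]^2 m) a = (3 : k) • LinearMap.id - (n : k) • (P + Q) :=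
      TensorProduct.ext' fun x w => by
        have hx : ⁅a, x⁆ = x - (n : k) • E x := LinearMap.congr_fun ha x
        simp only [toEnd_apply_apply, TensorProduct.LieModule.lie_tmul_right, hx,
          lie_eq_of_toEnd_eq ha, LinearMap.sub_apply, LinearMap.smul_apply, LinearMap.id_apply,
          LinearMap.add_apply, P, Q, LinearMap.rTensor_tmul, LinearMap.lTensor_tmul,
          TensorProduct.sub_tmul, TensorProduct.tmul_sub, TensorProduct.tmul_smul,
          TensorProduct.smul_tmul']
        simp only [← TensorProduct.smul_tmul']
        module
    exact LinearMap.congr_fun this t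
  refine eq_zero_of_quadratic_eq_zero (T := P + Q) hn (fun t => ?_) ?_
  · have := LinearMap.congr_fun (add_mul_sub_mul_sub_eq_zero hP hQ hPQ) t
    generalize P + Q = T at this ⊢
    have h3 (z) : (3 : Module.End k (m ⊗[k] ⋀[k]^2 m)) z = (3 : k) • z :=
      (Nat.cast_smul_eq_nsmul k 3 z).symm
    have h2 (z) : (2 : Module.End k (m ⊗[k] ⋀[k]^2 m)) z = (2 : k) • z :=
      (Nat.cast_smul_eq_nsmul k 2 z).symm
    simp only [LinearMap.add_apply, LinearMap.sub_apply, Module.End.mul_apply, h3, h2,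
      LinearMap.zero_apply] at this
    linear_combination (norm := module) this
  · generalize P + Q = T at hact ⊢
    simp only [hact, map_sub, map_smul] at ht
    linear_combination (norm := module) ht

/-- The rank-one idempotent has trace `φ v = 1`, so the coefficient `dim 𝔪` makes the total trace
zero. -/
theorem exists_toEnd_eq_of_range_eq_specialLinear [FiniteDimensional k m]
    (h : (toEnd k S m).range = specialLinear k m) {φ : m →ₗ[k] k} {v : m} (hφ : φ v = 1) :
    ∃ a, toEnd k S m a = 1 - (Module.finrank k m : k) • φ.smulRight v := by
  have : 1 - (Module.finrank k m : k) • φ.smulRight v ∈ specialLinear k m := by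
    change LinearMap.trace k m _ = 0
    simp [hφ]
  rw [← h] at this
  exact this

end Spectrum

/-! ### The main theorem. -/

theorem mainTheorem8 {k : Type*} [Field k] [CharZero k]
    {S : Type*} [LieRing S] [LieAlgebra k S] [FiniteDimensional k S] [LieAlgebra.IsSemisimple k S]
    {m : Type*} [AddCommGroup m] [Module k m] [FiniteDimensional k m]
    [LieRingModule S m] [LieModule k S m]
    (I : LieIdeal k (FreeNil3 k m))
    (hSI : FreeNil3.IsSIdeal S I)
    (hI : I ≤ LieModule.lowerCentralSeries k (FreeNil3 k m) (FreeNil3 k m) 1)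
    (hnil : IsNilpotentOfIndex k (FreeNil3 k m ⧸ I) 3)
    (hqc : ¬ IsQuasiCyclic k (FreeNil3 k m ⧸ I))
    (hnh : ¬ I.IsHomogeneousFor FreeNil3.component) :
    (∃ B : LieSubmodule k S (FreeNil3 k m),
      B.toSubmodule ≤ I.toSubmodule ∧
      LieModule.IsIrreducible k S B ∧
      B.map (FreeNil3.lieProj₂ k m S) ≠ ⊥ ∧
      B.map (FreeNil3.lieProj₃ k m S) ≠ ⊥ ∧
      Nonempty (B.map (FreeNil3.lieProj₂ k m S) ≃ₗ⁅k, S⁆ B.map (FreeNil3.lieProj₃ k m S))) ∧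
    (LieModule.toEnd k S m).range ≠ specialLinear k m ∧
    ¬ LieModule.IsIrreducible k S (FreeNil3.lcs k m S 2) := by
  have hI₁ : ∀ u ∈ I, FreeNil3.proj₁ k m u = 0 := fun u hu => FreeNil3.proj₁_eq_zero (hI hu)
  let IS : LieSubmodule k S (FreeNil3 k m) :=
    { I.toSubmodule with lie_mem := fun {a u} hu => hSI a u hu }
  let X : LieSubmodule k S (FreeNil3 k m) :=
    (IS ⊓ (FreeNil3.lieProj₂ k m S).ker) ⊔ (IS ⊓ (FreeNil3.lieProj₃ k m S).ker)
  have hX : X < IS := by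
    refine lt_of_le_of_ne (sup_le inf_le_left inf_le_left) fun heq => hnh ?_
    refine le_antisymm (fun u hu => ?_) (iSup_le fun j => inf_le_left)
    have hu' : u ∈ X := heq ▸ hu
    obtain ⟨b, hb, c, hc, rfl⟩ := (LieSubmodule.mem_sup _ _ _).mp hu'
    -- Elements of `I` have no part in degree 1, so killing the `⋀²𝔪` part leaves degree 3, and
    -- killing the `𝔰` part leaves degree 2.
    have hb' : b ∈ ⨆ j, I.toSubmodule ⊓ FreeNil3.component j :=
      Submodule.mem_iSup_of_mem 3 ⟨hb.1, hI₁ b hb.1, hb.2⟩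
    have hc' : c ∈ ⨆ j, I.toSubmodule ⊓ FreeNil3.component j :=
      Submodule.mem_iSup_of_mem 2 ⟨hc.1, hI₁ c hc.1, hc.2⟩
    exact add_mem hb' hc'
  obtain ⟨B, hBI, hirr, hdisj⟩ := LieSubmodule.exists_isIrreducible_disjoint hX
  have hB₂ : ∀ u ∈ B, FreeNil3.lieProj₂ k m S u = 0 → u = 0 := fun u hu h =>
    (LieSubmodule.eq_bot_iff _).mp hdisj.eq_bot u
      ⟨hu, LieSubmodule.mem_sup_left ⟨hBI hu, h⟩⟩
  have hB₃ : ∀ u ∈ B, FreeNil3.lieProj₃ k m S u = 0 → u = 0 := fun u hu h =>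
    (LieSubmodule.eq_bot_iff _).mp hdisj.eq_bot u
      ⟨hu, LieSubmodule.mem_sup_right ⟨hBI hu, h⟩⟩
  have hBnt : Nontrivial B := LieModule.nontrivial_of_isIrreducible k S B
  obtain ⟨⟨b, hb⟩, hb0⟩ := exists_ne (0 : B)
  replace hb0 : b ≠ 0 := fun h => hb0 (Subtype.ext h)
  have hb₂ : FreeNil3.lieProj₂ k m S b ≠ 0 := fun h => hb0 (hB₂ b hb h)
  have hb₃ : FreeNil3.lieProj₃ k m S b ≠ 0 := fun h => hb0 (hB₃ b hb h)
  refine ⟨⟨B, hBI, hirr, fun h => hb₂ ?_, fun h => hb₃ ?_,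
    ⟨(B.equivMapOfDisjointKer _ hB₂).symm.trans (B.equivMapOfDisjointKer _ hB₃)⟩⟩, ?_, ?_⟩
  · exact (LieSubmodule.eq_bot_iff _).mp h _ (LieSubmodule.mem_map_of_mem hb)
  · exact (LieSubmodule.eq_bot_iff _).mp h _ (LieSubmodule.mem_map_of_mem hb)
  · intro h
    have hn : 2 ≤ Module.finrank k m := by
      have : Nontrivial (⋀[k]^2 m) := ⟨_, _, hb₂⟩
      have h0 : Module.finrank k (⋀[k]^2 m) ≠ 0 := Module.finrank_pos.ne'
      rw [exteriorPower.finrank_eq] at h0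
      by_contra! hlt
      exact h0 (Nat.choose_eq_zero_of_lt hlt)
    have : Nontrivial m := Module.nontrivial_of_finrank_pos (R := k) (by omega)
    obtain ⟨v, hv⟩ := exists_ne (0 : m)
    obtain ⟨φ, hφ⟩ := Module.Projective.exists_dual_eq_one k hv
    obtain ⟨a, ha⟩ := exists_toEnd_eq_of_range_eq_specialLinear h hφ
    set n := Module.finrank k m
    have hmem : ⁅a, ⁅a, b⁆⁆ + (n - 4 : k) • ⁅a, b⁆ + (4 - 2 * n : k) • b ∈ B :=
      add_mem (add_mem (B.lie_mem (B.lie_mem hb)) (SMulMemClass.smul_mem _ (B.lie_mem hb)))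
        (SMulMemClass.smul_mem _ hb)
    -- The quadratic expression in `a` kills the `⋀²𝔪` part of `b`; injectivity on `B` transfers
    -- this to `b`, hence to its `𝔰` part.
    have hzero := hB₂ _ hmem (by
      simp only [map_add, map_smul, LieModuleHom.map_lie]
      exact ExtSq.quadratic_lie_eq_zero hφ ha _)
    have h₃ := congrArg (FreeNil3.lieProj₃ k m S) hzero
    simp only [map_add, map_smul, LieModuleHom.map_lie, map_zero] at h₃
    exact hb₃ (Subtype.ext (eq_zero_of_quadratic_lie_eq_zero hφ hn ha (congrArg Subtype.val h₃)))
  · intro hirr₃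
    have : Nontrivial m := by
      by_contra hm
      rw [not_nontrivial_iff_subsingleton] at hm
      refine hb₂ ?_
      have : (LinearMap.id : ⋀[k]^2 m →ₗ[k] ⋀[k]^2 m) = 0 := ExtSq.hom_ext fun y z => by
        simp [Subsingleton.elim y 0]
      exact LinearMap.congr_fun this _
    obtain ⟨v, hv⟩ := exists_ne (0 : m)
    let x : FreeNil3 k m := (v, 0, 0)
    have hxI : ⁅x, b⁆ ∈ I := lie_mem_right k (FreeNil3 k m) I x b (hBI hb)
    have hx₂ : ⁅x, b⁆ ∈ FreeNil3.lcs k m S 2 := by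
      change ⁅x, b⁆ ∈ LieModule.lowerCentralSeries k (FreeNil3 k m) (FreeNil3 k m) 2
      rw [LieModule.lowerCentralSeries_succ]
      exact LieSubmodule.lie_mem_lie (LieSubmodule.mem_top x) (hI (hBI hb))
    have hx0 : ⁅x, b⁆ ≠ 0 := fun h0 => by
      have h₃ := congrArg (FreeNil3.proj₃ k m) h0
      rw [FreeNil3.proj₃_lie, hI₁ b (hBI hb), map_zero, map_zero, LinearMap.zero_apply,
        sub_zero] at h₃
      exact hb₂ (FreeNil3.eq_zero_of_bracket₁₂_eq_zero hv h₃)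
    -- The submodule `I ∩ 𝒩³` of the irreducible module `𝒩³` contains the nonzero element `[x, b]`.
    have htop : IS.comap (FreeNil3.lcs k m S 2).incl = ⊤ := by
      refine (IsSimpleOrder.eq_bot_or_eq_top _).resolve_left fun h => hx0 ?_
      exact congrArg Subtype.val ((LieSubmodule.eq_bot_iff _).mp h ⟨_, hx₂⟩ hxI)
    have hle : LieModule.lowerCentralSeries k (FreeNil3 k m) (FreeNil3 k m) 2 ≤ I := fun u hu => by
      have : (⟨u, hu⟩ : FreeNil3.lcs k m S 2) ∈ IS.comap (FreeNil3.lcs k m S 2).incl :=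
        htop ▸ LieSubmodule.mem_top _
      exact this
    have h2 : LieModule.lowerCentralSeries k (FreeNil3 k m ⧸ I) (FreeNil3 k m ⧸ I) 2 = ⊥ := by
      let q : FreeNil3 k m →ₗ⁅k⁆ FreeNil3 k m ⧸ I :=
        { (LieSubmodule.Quotient.mk' I : FreeNil3 k m →ₗ[k] FreeNil3 k m ⧸ I) with
          map_lie' := rfl }
      rw [← LieIdeal.lowerCentralSeries_map_eq 2 (f := q)
        (LieSubmodule.Quotient.surjective_mk' I), LieIdeal.map_eq_bot_iff]
      intro u hu
      exact (LieSubmodule.Quotient.mk_eq_zero' (N := I)).mpr (hle hu)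
    -- Index 2 is the third term `𝔫³`, so its vanishing would give `3 ≤ 2`.
    exact absurd ((hnil 2).mp h2) (by norm_num)
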